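/- Let $E$ be a complex Banach space, let $E_{\mathbb R}$ be $E$ regarded as a real Banach space, and let $(E_{\mathbb R})^*$ be its real dual. For $f:(E_{\mathbb R})^*\to\mathbb R$ put $$\|f\|_{\mathrm{FBL}[E_{\mathbb R}]}=\sup\Big\{\sum_{j=1}^m|f(x_j^*)| : m\in\mathbb N,\ x_1^*,\dots,x_m^*\in (E_{\mathbb R})^*,\ \sup_{\|x\|\le 1}\sum_{j=1}^m|x_j^*(x)|\le 1\Big\},$$ let $H_1[E_{\mathbb R}]$ be the Banach lattice (pointwise order) of the positively homogeneous $f$ for which this is finite, and let $\mathrm{FBL}[E_{\mathbb R}]$ be the closed sublattice of $H_1[E_{\mathbb R}]$ generated by the evaluations $\delta_{E_{\mathbb R}}(x):x^*\mapsto x^*(x)$, $x\in E$. The free complex Banach lattice $\mathrm{FBL}_{\mathbb C}[E]$ is the complexification $\mathrm{FBL}[E_{\mathbb R}]\oplus i\,\mathrm{FBL}[E_{\mathbb R}]$, a space of functions $(E_{\mathbb R})^*\to\mathbb C$, with the norm $$\|f\|=\sup\Big\{\sum_{j=1}^m|f(\operatorname{Re} z_j^*)| : m\in\mathbb N,\ z_1^*,\dots,z_m^*\in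 E^*,\ \sup_{\|z\|\le 1}\sum_{j=1}^m|z_j^*(z)|\le 1\Big\},$$ and $\delta_E:E\to \mathrm{FBL}_{\mathbb C}[E]$ is the map $\delta_E(z)=\delta_{E_{\mathbb R}}(z)-i\,\delta_{E_{\mathbb R}}(iz)$. A complex lattice homomorphism of $\mathrm{FBL}_{\mathbb C}[E]$ is the complexification of a lattice homomorphism of $\mathrm{FBL}[E_{\mathbb R}]$. Let $T:E\to E$ be a bounded $\mathbb C$-linear operator and let $\overline T:\mathrm{FBL}_{\mathbb C}[E]\to\mathrm{FBL}_{\mathbb C}[E]$ be the unique bounded complex lattice homomorphism such that $\overline T\,\delta_E=\delta_E\,T$. If $\lambda\in\sigma(T)\cap[0,\infty)$, then $\lambda\in\sigma(\overline T)$. -/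

import Mathlib

open scoped ENNReal

noncomputable section

namespace FreeBL

section TupleNorm

variable {𝕜 : Type*} [RCLike 𝕜] {X : Type*} [NormedAddCommGroup X] [NormedSpace 𝕜 X]
  {V : Type*} [NormedAddCommGroup V]

/-- The finite sequence `x` of functionals satisfies `sup_{z ∈ B_X} ∑ |x_i(z)| ≤ 1`. -/
def WeakOneLE {n : ℕ} (x : Fin n → (X →L[𝕜] 𝕜)) : Prop :=
  ∀ z : X, ‖z‖ ≤ 1 → ∑ i, ‖x i z‖ ≤ 1

/-- The extended norm
`sup {∑ |f(x_i)| : (x_i) a finite sequence in X^*, sup_{z ∈ B_X} ∑ |x_i(z)| ≤ 1}`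
of a function `f` on the dual of `X`. -/
def freeNorm (f : (X →L[𝕜] 𝕜) → V) : ℝ≥0∞ :=
  ⨆ (n : ℕ) (x : Fin n → (X →L[𝕜] 𝕜)) (_ : WeakOneLE x), ∑ i, ‖f (x i)‖ₑ

theorem le_freeNorm (f : (X →L[𝕜] 𝕜) → V) {n : ℕ} (x : Fin n → (X →L[𝕜] 𝕜))
    (hx : WeakOneLE x) : ∑ i, ‖f (x i)‖ₑ ≤ freeNorm f :=
  le_iSup_of_le n (le_iSup_of_le x (le_iSup_of_le hx le_rfl))

theorem freeNorm_le {f : (X →L[𝕜] 𝕜) → V} {C : ℝ≥0∞}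
    (h : ∀ (n : ℕ) (x : Fin n → (X →L[𝕜] 𝕜)), WeakOneLE x → ∑ i, ‖f (x i)‖ₑ ≤ C) :
    freeNorm f ≤ C :=
  iSup_le fun n => iSup_le fun x => iSup_le fun hx => h n x hx

theorem freeNorm_mono {W : Type*} [NormedAddCommGroup W] {f : (X →L[𝕜] 𝕜) → V}
    {g : (X →L[𝕜] 𝕜) → W} (h : ∀ x, ‖f x‖ ≤ ‖g x‖) : freeNorm f ≤ freeNorm g :=
  freeNorm_le fun _ x hx =>
    (Finset.sum_le_sum fun i _ => enorm_le_iff_norm_le.2 (h (x i))).trans (le_freeNorm g x hx)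

theorem freeNorm_add_of_le {W W' : Type*} [NormedAddCommGroup W] [NormedAddCommGroup W']
    {f : (X →L[𝕜] 𝕜) → V} {g : (X →L[𝕜] 𝕜) → W} {h : (X →L[𝕜] 𝕜) → W'}
    (hf : ∀ x, ‖f x‖ ≤ ‖g x‖ + ‖h x‖) : freeNorm f ≤ freeNorm g + freeNorm h := by
  refine freeNorm_le fun n x hx => ?_
  calc ∑ i, ‖f (x i)‖ₑ ≤ ∑ i, (‖g (x i)‖ₑ + ‖h (x i)‖ₑ) := by
        refine Finset.sum_le_sum fun i _ => ?_
        rw [← ofReal_norm, ← ofReal_norm, ← ofReal_norm,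
          ← ENNReal.ofReal_add (norm_nonneg _) (norm_nonneg _)]
        exact ENNReal.ofReal_le_ofReal (hf _)
    _ = ∑ i, ‖g (x i)‖ₑ + ∑ i, ‖h (x i)‖ₑ := Finset.sum_add_distrib
    _ ≤ _ := add_le_add (le_freeNorm g x hx) (le_freeNorm h x hx)

theorem freeNorm_smul_eq {R : Type*} [NormedField R] [NormedSpace R V] (c : R)
    (f : (X →L[𝕜] 𝕜) → V) : freeNorm (fun x => c • f x) = ‖c‖ₑ * freeNorm f := by
  unfold freeNorm
  simp only [enorm_smul, ← Finset.mul_sum, ENNReal.mul_iSup]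

end TupleNorm

section Real

variable {F : Type*} [NormedAddCommGroup F] [NormedSpace ℝ F]

/-- The space `H_1[F]` of positively homogeneous functions on `F^*` of finite norm. -/
def H1 (F : Type*) [NormedAddCommGroup F] [NormedSpace ℝ F] :
    Submodule ℝ ((F →L[ℝ] ℝ) → ℝ) where
  carrier := {f | (∀ (c : ℝ) (x : F →L[ℝ] ℝ), 0 ≤ c → f (c • x) = c * f x) ∧ freeNorm f < ∞}
  add_mem' := by
    rintro f g ⟨hf, hf'⟩ ⟨hg, hg'⟩
    refine ⟨fun c x hc => by simp [hf c x hc, hg c x hc, mul_add], ?_⟩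
    exact (freeNorm_add_of_le (fun x => norm_add_le _ _)).trans_lt (ENNReal.add_lt_top.2 ⟨hf', hg'⟩)
  zero_mem' := ⟨by simp, by simp [freeNorm]⟩
  smul_mem' := by
    rintro a f ⟨hf, hf'⟩
    refine ⟨fun c x hc => by simp [hf c x hc]; ring, ?_⟩
    exact (freeNorm_smul_eq a f).trans_lt (ENNReal.mul_lt_top (by simp) hf')

/-- The evaluation function `x^* ↦ x^*(x)`. -/
def evalAt (x : F) : (F →L[ℝ] ℝ) → ℝ := fun φ => φ x

/-- `p` is a norm-closed vector sublattice of `H_1[F]` (closed under `⊔`, hence under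
`f ⊓ g = -(-f ⊔ -g)`). -/
structure IsClosedSublattice (p : Submodule ℝ ((F →L[ℝ] ℝ) → ℝ)) : Prop where
  le_H1 : p ≤ H1 F
  sup_mem : ∀ f ∈ p, ∀ g ∈ p, f ⊔ g ∈ p
  closed : ∀ f ∈ H1 F, (∀ ε : ℝ≥0∞, 0 < ε → ∃ g ∈ p, freeNorm (f - g) < ε) → f ∈ p

/-- The free Banach lattice `FBL[F]`: the closed sublattice of `H_1[F]` generated by the
evaluation functions. -/
def FBL (F : Type*) [NormedAddCommGroup F] [NormedSpace ℝ F] :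
    Submodule ℝ ((F →L[ℝ] ℝ) → ℝ) :=
  sInf {p | IsClosedSublattice p ∧ ∀ x : F, evalAt x ∈ p}

theorem evalAt_mem_H1 (x : F) : evalAt x ∈ H1 F := by
  refine ⟨fun c φ _ => by simp [evalAt], ?_⟩
  refine lt_of_le_of_lt (freeNorm_le (C := ENNReal.ofReal (‖x‖)) fun n φ hφ => ?_)
    ENNReal.ofReal_lt_top
  simp only [evalAt, ← ofReal_norm]
  rw [← ENNReal.ofReal_sum_of_nonneg fun _ _ => norm_nonneg _]
  refine ENNReal.ofReal_le_ofReal ?_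
  rcases eq_or_ne x 0 with rfl | hx
  · simp
  · have hx' : 0 < ‖x‖ := norm_pos_iff.2 hx
    have := hφ (‖x‖⁻¹ • x) (by simp [norm_smul, hx'.ne'])
    simp only [map_smul, norm_smul, norm_inv, norm_norm, ← Finset.mul_sum] at this
    rwa [inv_mul_le_iff₀ hx', mul_one] at this

theorem isClosedSublattice_H1 : IsClosedSublattice (H1 F) where
  le_H1 := le_rfl
  sup_mem := by
    rintro f ⟨hf, hf'⟩ g ⟨hg, hg'⟩
    refine ⟨fun c x hc => ?_, ?_⟩
    · simp only [Pi.sup_apply, hf c x hc, hg c x hc]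
      exact (mul_max_of_nonneg _ _ hc).symm
    · refine (freeNorm_add_of_le (g := f) (h := g) fun x => ?_).trans_lt
        (ENNReal.add_lt_top.2 ⟨hf', hg'⟩)
      simp only [Pi.sup_apply, Real.norm_eq_abs]
      rcases le_total (f x) (g x) with h | h
      · simp [h]
      · simp [h]
  closed := fun f hf _ => hf

theorem FBL_le {p : Submodule ℝ ((F →L[ℝ] ℝ) → ℝ)} (hp : IsClosedSublattice p)
    (h : ∀ x : F, evalAt x ∈ p) : FBL F ≤ p :=
  sInf_le ⟨hp, h⟩

theorem evalAt_mem (x : F) : evalAt x ∈ FBL F := by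
  simp only [FBL, Submodule.mem_sInf]
  exact fun p hp => hp.2 x

theorem isClosedSublattice_FBL : IsClosedSublattice (FBL F) where
  le_H1 := FBL_le isClosedSublattice_H1 evalAt_mem_H1
  sup_mem := by
    intro f hf g hg
    simp only [FBL, Submodule.mem_sInf] at *
    exact fun p hp => hp.1.sup_mem f (hf p hp) g (hg p hp)
  closed := by
    intro f hf h
    simp only [FBL, Submodule.mem_sInf]
    intro p hp
    refine hp.1.closed f hf fun ε hε => ?_
    obtain ⟨g, hg, hg'⟩ := h ε hε
    exact ⟨g, FBL_le hp.1 hp.2 hg, hg'⟩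

/-- `FBL[F]` is a lattice in the pointwise order. -/
instance : Lattice (FBL F) :=
  Subtype.lattice (fun {f g} hf hg => isClosedSublattice_FBL.sup_mem f hf g hg)
    (fun {f g} hf hg => by
      have h := (FBL F).neg_mem (isClosedSublattice_FBL.sup_mem _ ((FBL F).neg_mem hf) _
        ((FBL F).neg_mem hg))
      rwa [neg_sup, neg_neg, neg_neg] at h)

theorem coe_sup (f g : FBL F) : ((f ⊔ g : FBL F) : (F →L[ℝ] ℝ) → ℝ) = (f : _ → ℝ) ⊔ g := rfl

end Real

section Complex

variable {E : Type*} [NormedAddCommGroup E] [NormedSpace ℂ E]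

/-- The real part of a complex functional, a functional on the underlying real space. -/
def rePart (z : E →L[ℂ] ℂ) : E →L[ℝ] ℝ := Complex.reCLM.comp (z.restrictScalars ℝ)

/-- The complexification `FBL[E_ℝ] ⊕ i FBL[E_ℝ]`, as the space of complex functions on
`(E_ℝ)^*` whose real and imaginary parts are in `FBL[E_ℝ]`. -/
def complexFBL (E : Type*) [NormedAddCommGroup E] [NormedSpace ℂ E] :
    Submodule ℂ ((E →L[ℝ] ℝ) → ℂ) where
  carrier := {f | (fun x => (f x).re) ∈ FBL E ∧ (fun x => (f x).im) ∈ FBL E}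
  add_mem' := fun hf hg => ⟨(FBL E).add_mem hf.1 hg.1, (FBL E).add_mem hf.2 hg.2⟩
  zero_mem' := ⟨(FBL E).zero_mem, (FBL E).zero_mem⟩
  smul_mem' := by
    rintro c f ⟨h1, h2⟩
    constructor
    · convert (FBL E).sub_mem ((FBL E).smul_mem c.re h1) ((FBL E).smul_mem c.im h2) using 1
      ext x; simp
    · convert (FBL E).add_mem ((FBL E).smul_mem c.re h2) ((FBL E).smul_mem c.im h1) using 1
      ext x; simp

/-- The free complex Banach lattice `FBL_ℂ[E]`. (A separate type, so that it carries the norm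
below and not the topology of pointwise convergence.) -/
def FBLC (E : Type*) [NormedAddCommGroup E] [NormedSpace ℂ E] : Type _ := complexFBL E

namespace FBLC

instance : AddCommGroup (FBLC E) := inferInstanceAs (AddCommGroup (complexFBL E))

instance : Module ℂ (FBLC E) := inferInstanceAs (Module ℂ (complexFBL E))

/-- The function on `(E_ℝ)^*` given by an element of `FBL_ℂ[E]`. -/
def toFun (f : FBLC E) : (E →L[ℝ] ℝ) → ℂ := f.1

instance : CoeFun (FBLC E) fun _ => (E →L[ℝ] ℝ) → ℂ := ⟨toFun⟩

@[ext] theorem ext {f g : FBLC E} (h : ∀ x, f x = g x) : f = g := Subtype.ext (funext h)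

@[simp] theorem add_apply (f g : FBLC E) (x : E →L[ℝ] ℝ) : (f + g) x = f x + g x := rfl

@[simp] theorem smul_apply (c : ℂ) (f : FBLC E) (x : E →L[ℝ] ℝ) : (c • f) x = c * f x := rfl

@[simp] theorem sub_apply (f g : FBLC E) (x : E →L[ℝ] ℝ) : (f - g) x = f x - g x := rfl

@[simp] theorem zero_apply (x : E →L[ℝ] ℝ) : (0 : FBLC E) x = 0 := rfl

/-- The real part of an element of `FBL_ℂ[E] = FBL[E_ℝ] ⊕ i FBL[E_ℝ]`. -/
def re (f : FBLC E) : FBL E := ⟨fun x => (f x).re, f.2.1⟩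

/-- The imaginary part of an element of `FBL_ℂ[E] = FBL[E_ℝ] ⊕ i FBL[E_ℝ]`. -/
def im (f : FBLC E) : FBL E := ⟨fun x => (f x).im, f.2.2⟩

/-- The element `f + i g` of `FBL_ℂ[E]`. -/
def mk (f g : FBL E) : FBLC E :=
  ⟨fun x => ⟨(f : (E →L[ℝ] ℝ) → ℝ) x, (g : (E →L[ℝ] ℝ) → ℝ) x⟩, f.2, g.2⟩

/-- `‖f‖ = sup {∑ |f(Re z_j^*)| : (z_j^*) finite in E^*, sup_{z ∈ B_E} ∑ |z_j^*(z)| ≤ 1}`;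
the supremum is finite by `norm_ne_top`. -/
instance : Norm (FBLC E) := ⟨fun f => (freeNorm fun z : E →L[ℂ] ℂ => f (rePart z)).toReal⟩

theorem norm_def (f : FBLC E) :
    ‖f‖ = (freeNorm fun z : E →L[ℂ] ℂ => f (rePart z)).toReal := rfl

theorem freeNorm_rePart_le (f : (E →L[ℝ] ℝ) → ℝ) :
    freeNorm (fun z : E →L[ℂ] ℂ => f (rePart z)) ≤ freeNorm f := by
  refine freeNorm_le fun n z hz => le_freeNorm f (fun i => rePart (z i)) fun w hw => ?_
  exact (Finset.sum_le_sum fun i _ => Complex.abs_re_le_norm (z i w)).trans (hz w hw)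

theorem freeNorm_le_re_add_im (f : FBLC E) :
    freeNorm (fun z : E →L[ℂ] ℂ => f (rePart z)) ≤
      freeNorm (f.re : (E →L[ℝ] ℝ) → ℝ) + freeNorm (f.im : (E →L[ℝ] ℝ) → ℝ) :=
  (freeNorm_add_of_le fun z => Complex.norm_le_abs_re_add_abs_im (f (rePart z))).trans
    (add_le_add (freeNorm_rePart_le _) (freeNorm_rePart_le _))

theorem norm_ne_top (f : FBLC E) : freeNorm (fun z : E →L[ℂ] ℂ => f (rePart z)) ≠ ∞ :=
  ((freeNorm_le_re_add_im f).trans_lt (ENNReal.add_lt_top.2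
    ⟨(isClosedSublattice_FBL.le_H1 f.re.2).2, (isClosedSublattice_FBL.le_H1 f.im.2).2⟩)).ne

theorem smul_nonneg (f : FBLC E) {c : ℝ} (hc : 0 ≤ c) (x : E →L[ℝ] ℝ) :
    f (c • x) = c * f x := by
  apply Complex.ext
  · have h : (f (c • x)).re = c * (f x).re := (isClosedSublattice_FBL.le_H1 f.re.2).1 c x hc
    simpa using h
  · have h : (f (c • x)).im = c * (f x).im := (isClosedSublattice_FBL.le_H1 f.im.2).1 c x hc
    simpa using h

theorem exists_rePart (x : E →L[ℝ] ℝ) : ∃ z : E →L[ℂ] ℂ, rePart z = x := by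
  refine ⟨StrongDual.extendRCLike (𝕜 := ℂ) x, ?_⟩
  ext w
  simp [rePart, StrongDual.extendRCLike_apply]

theorem eq_zero_of_norm (f : FBLC E) (h : ‖f‖ = 0) : f = 0 := by
  have h0 : freeNorm (fun z : E →L[ℂ] ℂ => f (rePart z)) = 0 :=
    ((ENNReal.toReal_eq_zero_iff _).1 h).resolve_right (norm_ne_top f)
  ext x
  obtain ⟨z, rfl⟩ := exists_rePart x
  have hz : 0 < ‖z‖ + 1 := by positivity
  have h1 : ‖f (rePart ((‖z‖ + 1)⁻¹ • z))‖ₑ ≤ 0 := by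
    rw [← h0]
    refine le_trans (by simp) (le_freeNorm (fun z : E →L[ℂ] ℂ => f (rePart z))
      (fun _ : Fin 1 => (‖z‖ + 1)⁻¹ • z) fun w hw => ?_)
    simp only [Finset.univ_unique, Finset.sum_const, Finset.card_singleton, one_smul]
    rw [_root_.smul_apply, norm_smul, Real.norm_of_nonneg (by positivity),
      inv_mul_le_iff₀ hz]
    have := z.le_opNorm w
    nlinarith [norm_nonneg z, norm_nonneg w]
  have h2 : rePart ((‖z‖ + 1)⁻¹ • z) = (‖z‖ + 1)⁻¹ • rePart z := by
    ext w; simp [rePart]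
  rw [h2, smul_nonneg f (by positivity)] at h1
  have h3 := enorm_eq_zero.1 (le_antisymm h1 zero_le)
  exact (mul_eq_zero.1 h3).resolve_left (by exact_mod_cast (inv_pos.2 hz).ne')

theorem normCore : NormedSpace.Core ℂ (FBLC E) where
  norm_nonneg _ := ENNReal.toReal_nonneg
  norm_smul c f := by
    rw [norm_def, norm_def]
    have := freeNorm_smul_eq c fun z : E →L[ℂ] ℂ => f (rePart z)
    simp only [smul_eq_mul] at this
    simp [this]
  norm_triangle f g := by
    rw [norm_def, norm_def, norm_def, ← ENNReal.toReal_add (norm_ne_top f) (norm_ne_top g)]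
    exact ENNReal.toReal_mono (ENNReal.add_ne_top.2 ⟨norm_ne_top f, norm_ne_top g⟩)
      (freeNorm_add_of_le fun z => norm_add_le _ _)
  norm_eq_zero_iff f := by
    refine ⟨eq_zero_of_norm f, ?_⟩
    rintro rfl
    simp [norm_def, freeNorm]

instance : NormedAddCommGroup (FBLC E) := NormedAddCommGroup.ofCore normCore

instance : NormedSpace ℂ (FBLC E) := NormedSpace.ofCore normCore

theorem norm_eq (f : FBLC E) :
    ‖f‖ = (freeNorm fun z : E →L[ℂ] ℂ => f (rePart z)).toReal := rfl

end FBLC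

/-- The canonical embedding `δ_E(z) = δ_{E_ℝ}(z) - i δ_{E_ℝ}(iz)`. -/
def delta (z : E) : FBLC E :=
  FBLC.mk ⟨evalAt z, evalAt_mem z⟩ (-⟨evalAt (Complex.I • z), evalAt_mem _⟩)

/-- A complex lattice homomorphism of `FBL_ℂ[E]`: the complexification of a (real-linear)
lattice homomorphism of `FBL[E_ℝ]`. -/
def IsComplexLatticeHom (S : FBLC E →L[ℂ] FBLC E) : Prop :=
  ∃ R : FBL E →ₗ[ℝ] FBL E,
    (∀ f g, R (f ⊔ g) = R f ⊔ R g) ∧ (∀ f g, R (f ⊓ g) = R f ⊓ R g) ∧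
      ∀ f g : FBL E, S (FBLC.mk f g) = FBLC.mk (R f) (R g)

theorem freeNorm_comp_le {𝕜 X V : Type*} [RCLike 𝕜] [NormedAddCommGroup X] [NormedSpace 𝕜 X]
    [NormedAddCommGroup V] (T : X →L[𝕜] X) {f : (X →L[𝕜] 𝕜) → V}
    (hf : ∀ (c : ℝ) (x : X →L[𝕜] 𝕜), 0 ≤ c → ‖f ((c : 𝕜) • x)‖ = c * ‖f x‖) :
    freeNorm (fun x => f (x.comp T)) ≤ ENNReal.ofReal (‖T‖ + 1) * freeNorm f := by
  have hT : 0 < ‖T‖ + 1 := by positivity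
  refine freeNorm_le fun n x hx => ?_
  have h := le_freeNorm f (fun i => (((‖T‖ + 1)⁻¹ : ℝ) : 𝕜) • (x i).comp T) fun z hz => by
    have := hx ((((‖T‖ + 1)⁻¹ : ℝ) : 𝕜) • T z) (by
      rw [norm_smul, RCLike.norm_ofReal, abs_of_pos (by positivity), inv_mul_le_iff₀ hT]
      nlinarith [T.le_opNorm z, norm_nonneg T, norm_nonneg z])
    simpa using this
  calc ∑ i, ‖f ((x i).comp T)‖ₑ
      = ENNReal.ofReal (‖T‖ + 1) * ∑ i, ‖f ((((‖T‖ + 1)⁻¹ : ℝ) : 𝕜) • (x i).comp T)‖ₑ := by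
        rw [Finset.mul_sum]
        refine Finset.sum_congr rfl fun i _ => ?_
        rw [← ofReal_norm, ← ofReal_norm, hf _ _ (by positivity), ← ENNReal.ofReal_mul hT.le,
          mul_inv_cancel_left₀ hT.ne']
    _ ≤ _ := by gcongr

theorem comp_mem_FBL {F : Type*} [NormedAddCommGroup F] [NormedSpace ℝ F] (T : F →L[ℝ] F)
    {f : (F →L[ℝ] ℝ) → ℝ} (hf : f ∈ FBL F) : (fun x => f (x.comp T)) ∈ FBL F := by
  let L : ((F →L[ℝ] ℝ) → ℝ) →ₗ[ℝ] ((F →L[ℝ] ℝ) → ℝ) := LinearMap.funLeft ℝ ℝ fun x => x.comp T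
  have hH : ∀ f ∈ H1 F, freeNorm (L f) ≤ ENNReal.ofReal (‖T‖ + 1) * freeNorm f := fun f hf =>
    freeNorm_comp_le T fun c x hc => by
      have := hf.1 c x hc
      simp only [RCLike.ofReal_real_eq_id, id_eq, this, norm_mul, Real.norm_of_nonneg hc]
  have key : FBL F ≤ H1 F ⊓ (FBL F).comap L := by
    refine FBL_le ⟨inf_le_left, ?_, ?_⟩ ?_
    · rintro f ⟨hf1, hf2⟩ g ⟨hg1, hg2⟩
      exact ⟨isClosedSublattice_H1.sup_mem f hf1 g hg1,
        isClosedSublattice_FBL.sup_mem _ hf2 _ hg2⟩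
    · intro f hf h
      refine ⟨hf, isClosedSublattice_FBL.closed _ ⟨fun c x hc => ?_, ?_⟩ fun ε hε => ?_⟩
      · have := hf.1 c (x.comp T) hc
        simpa [L, LinearMap.funLeft_apply] using this
      · exact (hH f hf).trans_lt (ENNReal.mul_lt_top ENNReal.ofReal_lt_top hf.2)
      · have hC : ENNReal.ofReal (‖T‖ + 1) ≠ 0 := by
          rw [Ne, ENNReal.ofReal_eq_zero, not_le]; positivity
        obtain ⟨g, hg, hg'⟩ := h (ε / ENNReal.ofReal (‖T‖ + 1))
          (ENNReal.div_pos hε.ne' ENNReal.ofReal_ne_top)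
        refine ⟨L g, hg.2, ?_⟩
        rw [← map_sub]
        refine (hH _ ((H1 F).sub_mem hf hg.1)).trans_lt ?_
        rw [mul_comm]
        exact ENNReal.mul_lt_of_lt_div hg'
    · intro x
      exact ⟨evalAt_mem_H1 x, evalAt_mem (T x)⟩
  exact (key hf).2

/-- Composition with the adjoint, `f ↦ f ∘ T^*`, on `FBL_ℂ[E]`. -/
def compHom (T : E →L[ℂ] E) : FBLC E →L[ℂ] FBLC E :=
  LinearMap.mkContinuous
    { toFun := fun f => ⟨fun x => f (x.comp (T.restrictScalars ℝ)),
        comp_mem_FBL (T.restrictScalars ℝ) f.2.1, comp_mem_FBL (T.restrictScalars ℝ) f.2.2⟩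
      map_add' := fun _ _ => rfl
      map_smul' := fun _ _ => rfl }
    (‖T‖ + 1) fun f => by
      have h := freeNorm_comp_le T (f := fun z : E →L[ℂ] ℂ => f (rePart z)) fun c z hc => by
        have : rePart ((c : ℂ) • z) = c • rePart z := by ext w; simp [rePart]
        simp only [Complex.coe_algebraMap, this, FBLC.smul_nonneg f hc, norm_mul,
          Complex.norm_real, Real.norm_of_nonneg hc]
      have h' := ENNReal.toReal_mono
        (ENNReal.mul_ne_top ENNReal.ofReal_ne_top (FBLC.norm_ne_top f)) h
      rwa [ENNReal.toReal_mul, ENNReal.toReal_ofReal (by positivity)] at h'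

theorem compHom_apply (T : E →L[ℂ] E) (f : FBLC E) (x : E →L[ℝ] ℝ) :
    compHom T f x = f (x.comp (T.restrictScalars ℝ)) := rfl

theorem compHom_delta (T : E →L[ℂ] E) (z : E) : compHom T (delta z) = delta (T z) := by
  ext x
  apply Complex.ext
  · rfl
  · change -(x (T (Complex.I • z))) = -(x (Complex.I • T z))
    rw [map_smul]

theorem isComplexLatticeHom_compHom (T : E →L[ℂ] E) : IsComplexLatticeHom (compHom T) :=
  ⟨{ toFun := fun f => ⟨_, comp_mem_FBL (T.restrictScalars ℝ) f.2⟩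
     map_add' := fun _ _ => rfl
     map_smul' := fun _ _ => rfl }, fun _ _ => rfl, fun _ _ => rfl, fun _ _ => rfl⟩

/-- Complex lattice homomorphisms that agree on the range of `δ_E` are equal. -/
theorem latticeHom_ext {S S' : FBLC E →L[ℂ] FBLC E} (hS : IsComplexLatticeHom S)
    (hS' : IsComplexLatticeHom S') (h : ∀ z, S (delta z) = S' (delta z)) : S = S' := by
  obtain ⟨R, hR, -, hRS⟩ := hS
  obtain ⟨R', hR', -, hRS'⟩ := hS'
  have hre : ∀ a b a' b' : FBL E, FBLC.mk a b = FBLC.mk a' b' → a = a' := by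
    intro a b a' b' hab
    exact congrArg FBLC.re hab
  have key : FBL E ≤ (LinearMap.eqLocus R R').map (FBL E).subtype := by
    refine FBL_le ⟨?_, ?_, ?_⟩ ?_
    · rintro _ ⟨f, -, rfl⟩
      exact isClosedSublattice_FBL.le_H1 f.2
    · rintro _ ⟨f, hf, rfl⟩ _ ⟨g, hg, rfl⟩
      refine ⟨f ⊔ g, ?_, rfl⟩
      change R (f ⊔ g) = R' (f ⊔ g)
      rw [hR, hR', show R f = R' f from hf, show R g = R' g from hg]
    · intro f hf hcl
      have hfm : f ∈ FBL E := isClosedSublattice_FBL.closed f hf fun ε hε => by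
        obtain ⟨_, ⟨g, -, rfl⟩, hg'⟩ := hcl ε hε
        exact ⟨_, g.2, hg'⟩
      refine ⟨⟨f, hfm⟩, ?_, rfl⟩
      have hmem : FBLC.mk ⟨f, hfm⟩ 0 ∈ closure {u : FBLC E | S u = S' u} := by
        rw [Metric.mem_closure_iff]
        intro ε hε
        obtain ⟨_, ⟨g, hg, rfl⟩, hg'⟩ := hcl (ENNReal.ofReal ε) (ENNReal.ofReal_pos.2 hε)
        refine ⟨FBLC.mk g 0, ?_, ?_⟩
        · change S _ = S' _
          rw [hRS, hRS', show R g = R' g from hg, map_zero, map_zero]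
        · rw [dist_eq_norm, FBLC.norm_eq]
          have h1 := FBLC.freeNorm_le_re_add_im (FBLC.mk ⟨f, hfm⟩ 0 - FBLC.mk g 0)
          have h2 : freeNorm ((FBLC.mk ⟨f, hfm⟩ 0 - FBLC.mk g 0 : FBLC E).im :
              (E →L[ℝ] ℝ) → ℝ) = 0 := by
            have h5 : ((FBLC.mk ⟨f, hfm⟩ 0 - FBLC.mk g 0 : FBLC E).im :
                (E →L[ℝ] ℝ) → ℝ) = fun _ => 0 := by
              funext x
              exact sub_self (0 : ℝ)
            rw [h5]
            simp [freeNorm]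
          rw [h2, add_zero] at h1
          have h3 := h1.trans_lt hg'
          exact (ENNReal.lt_ofReal_iff_toReal_lt h3.ne_top).1 h3
      rw [(isClosed_eq S.continuous S'.continuous).closure_eq] at hmem
      have h4 : S _ = S' _ := hmem
      rw [hRS, hRS'] at h4
      exact hre _ _ _ _ h4
    · intro x
      refine ⟨⟨evalAt x, evalAt_mem x⟩, ?_, rfl⟩
      have h4 := h x
      unfold delta at h4
      rw [hRS, hRS'] at h4
      exact hre _ _ _ _ h4
  have hRR : ∀ f, R f = R' f := by
    intro f
    obtain ⟨g, hg, hgf⟩ := key f.2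
    obtain rfl : g = f := Subtype.ext hgf
    exact hg
  ext1 u
  change S (FBLC.mk u.re u.im) = S' (FBLC.mk u.re u.im)
  rw [hRS, hRS', hRR, hRR]

theorem existsUnique_extension (T : E →L[ℂ] E) :
    ∃! S : FBLC E →L[ℂ] FBLC E, IsComplexLatticeHom S ∧ ∀ z, S (delta z) = delta (T z) :=
  ⟨compHom T, ⟨isComplexLatticeHom_compHom T, compHom_delta T⟩, fun S hS =>
    latticeHom_ext hS.1 (isComplexLatticeHom_compHom T) fun z => by
      rw [hS.2, compHom_delta]⟩

/-- The operator `T̄`: the unique lattice homomorphism of `FBL_ℂ[E]` with `T̄ δ_E = δ_E T`. -/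
def extension (T : E →L[ℂ] E) : FBLC E →L[ℂ] FBLC E := (existsUnique_extension T).choose

end Complex

end FreeBL

end

/-!
If `c - T` is not invertible, then either it is not bounded below or its range is not dense.
The first defect passes to `c - T̄`, because `δ_E` is an isometry intertwining `T` with `T̄`.
In the second case Hahn-Banach gives `w ≠ 0` in `E^*` with `w ∘ T = c w`. Since `T̄ f = f ∘ T^*`
and the elements of `FBL_ℂ[E]` are positively homogeneous, `c = r ≥ 0` yields
`(T̄ f)(Re w) = f(r Re w) = r f(Re w)`: evaluation at `Re w` is an eigenvector of the adjoint
of `T̄`, so `r - T̄` is not surjective.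
-/

namespace FreeBL

section OperatorSpectrum

theorem antilipschitzWith_of_semiconj_isometry {α β : Type*} [PseudoEMetricSpace α]
    [PseudoEMetricSpace β] {J : α → β} {A : α → α} {B : β → β} {K : NNReal} (hJ : Isometry J)
    (h : Function.Semiconj J A B) (hB : AntilipschitzWith K B) : AntilipschitzWith K A := by
  intro x y
  rw [← hJ x y, ← hJ (A x) (A y), h x, h y]
  exact hB (J x) (J y)

theorem exists_antilipschitzWith_of_notMem_spectrum {𝕜 X : Type*} [NontriviallyNormedField 𝕜]
    [NormedAddCommGroup X] [NormedSpace 𝕜 X] {T : X →L[𝕜] X} {c : 𝕜} (hc : c ∉ spectrum 𝕜 T) :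
    ∃ K, AntilipschitzWith K (algebraMap 𝕜 (X →L[𝕜] X) c - T) := by
  obtain ⟨u, hu⟩ := spectrum.notMem_iff.1 hc
  rw [← hu]
  exact ⟨_, (ContinuousLinearEquiv.ofUnit u).antilipschitz⟩

theorem mem_spectrum_of_comp_eq_smul {R M N : Type*} [CommRing R] [AddCommGroup M] [Module R M]
    [TopologicalSpace M] [IsTopologicalAddGroup M] [ContinuousConstSMul R M] [AddCommGroup N]
    [Module R N] {S : M →L[R] M} {c : R} {ψ : M →ₗ[R] N} (hψ : ψ ≠ 0)
    (h : ψ ∘ₗ S.toLinearMap = c • ψ) : c ∈ spectrum R S := by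
  by_contra hc
  obtain ⟨Q, hQ, -⟩ := isUnit_iff_exists.1 (spectrum.notMem_iff.1 hc)
  refine hψ (LinearMap.ext fun f => ?_)
  have hf : c • Q f - S (Q f) = f := by
    simpa [Algebra.algebraMap_eq_smul_one] using DFunLike.congr_fun hQ f
  have hψS : ψ (S (Q f)) = c • ψ (Q f) := LinearMap.congr_fun h (Q f)
  rw [← hf, map_sub, map_smul, hψS, sub_self, LinearMap.zero_apply]

variable {𝕜 X : Type*} [RCLike 𝕜] [NormedAddCommGroup X] [NormedSpace 𝕜 X]

theorem exists_dual_ne_zero_le_ker_of_topologicalClosure_ne_top {p : Submodule 𝕜 X}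
    (hp : p.topologicalClosure ≠ ⊤) : ∃ w : X →L[𝕜] 𝕜, w ≠ 0 ∧ p ≤ w.ker := by
  obtain ⟨x, -, hx⟩ := SetLike.exists_of_lt hp.lt_top
  have : IsClosed (p.topologicalClosure : Set X) := p.isClosed_topologicalClosure
  obtain ⟨g, hg⟩ := SeparatingDual.exists_ne_zero (R := 𝕜) (x := p.topologicalClosure.mkQ x)
    (by simpa using hx)
  refine ⟨g.comp p.topologicalClosure.mkQL, fun h => hg (DFunLike.congr_fun h x), fun y hy => ?_⟩
  have hy' : p.topologicalClosure.mkQ y = 0 := by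
    simpa using p.le_topologicalClosure hy
  change g (p.topologicalClosure.mkQ y) = 0
  rw [hy', map_zero]

theorem exists_comp_eq_smul_of_mem_spectrum_of_antilipschitzWith [CompleteSpace X]
    {T : X →L[𝕜] X} {c : 𝕜} {K : NNReal} (hc : c ∈ spectrum 𝕜 T)
    (hK : AntilipschitzWith K (algebraMap 𝕜 (X →L[𝕜] X) c - T)) :
    ∃ w : X →L[𝕜] 𝕜, w ≠ 0 ∧ w.comp T = c • w := by
  have hrange : (algebraMap 𝕜 (X →L[𝕜] X) c - T).range.topologicalClosure ≠ ⊤ := by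
    intro h
    rw [spectrum.mem_iff, ContinuousLinearMap.isUnit_iff_bijective,
      ContinuousLinearMap.bijective_iff_dense_range_and_antilipschitz] at hc
    exact hc ⟨h, K, hK⟩
  obtain ⟨w, hw, hker⟩ := exists_dual_ne_zero_le_ker_of_topologicalClosure_ne_top hrange
  refine ⟨w, hw, ContinuousLinearMap.ext fun x => ?_⟩
  have hx : w ((algebraMap 𝕜 (X →L[𝕜] X) c - T) x) = 0 := hker ⟨x, rfl⟩
  rw [sub_apply, map_sub, sub_eq_zero] at hx
  simpa [Algebra.algebraMap_eq_smul_one] using hx.symm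

end OperatorSpectrum

section EvaluationNorm

variable {𝕜 : Type*} [RCLike 𝕜] {X : Type*} [NormedAddCommGroup X] [NormedSpace 𝕜 X]

theorem WeakOneLE.sum_norm_apply_le {n : ℕ} {φ : Fin n → (X →L[𝕜] 𝕜)} (hφ : WeakOneLE φ)
    (x : X) : ∑ i, ‖φ i x‖ ≤ ‖x‖ := by
  rcases eq_or_ne x 0 with rfl | hx
  · simp
  have hx' : 0 < ‖x‖ := norm_pos_iff.2 hx
  have h := hφ (((‖x‖⁻¹ : ℝ) : 𝕜) • x) (by simp [norm_smul, hx'.ne'])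
  simp only [map_smul, norm_smul, RCLike.norm_ofReal, abs_inv, abs_norm, ← Finset.mul_sum] at h
  rwa [inv_mul_le_iff₀ hx', mul_one] at h

theorem weakOneLE_of_norm_le_one {φ : X →L[𝕜] 𝕜} (hφ : ‖φ‖ ≤ 1) :
    WeakOneLE fun _ : Fin 1 => φ := fun x hx => by
  simpa using (φ.le_of_opNorm_le hφ x).trans (by simpa using hx)

theorem freeNorm_eval (x : X) : freeNorm (fun φ : X →L[𝕜] 𝕜 => φ x) = ‖x‖ₑ := by
  apply le_antisymm
  · refine freeNorm_le fun n φ hφ => ?_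
    simp only [← ofReal_norm]
    rw [← ENNReal.ofReal_sum_of_nonneg fun _ _ => norm_nonneg _]
    exact ENNReal.ofReal_le_ofReal (hφ.sum_norm_apply_le x)
  · obtain ⟨g, hg, hgx⟩ := exists_dual_vector'' 𝕜 x
    calc ‖x‖ₑ = ∑ _i : Fin 1, ‖g x‖ₑ := by simp [← ofReal_norm, hgx]
      _ ≤ _ := le_freeNorm (fun φ : X →L[𝕜] 𝕜 => φ x) _ (weakOneLE_of_norm_le_one hg)

end EvaluationNorm

section Extension

variable {E : Type*} [NormedAddCommGroup E] [NormedSpace ℂ E]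

theorem delta_apply_rePart (z : E) (w : E →L[ℂ] ℂ) : delta z (rePart w) = w z := by
  apply Complex.ext
  · rfl
  · change -(w (Complex.I • z)).re = (w z).im
    simp

theorem norm_delta (z : E) : ‖delta z‖ = ‖z‖ := by
  rw [FBLC.norm_def]
  simp only [delta_apply_rePart, freeNorm_eval, toReal_enorm]

/-- The embedding `δ_E` as a linear isometry of `E` into `FBL_ℂ[E]`. -/
noncomputable def deltaLinearIsometry (E : Type*) [NormedAddCommGroup E] [NormedSpace ℂ E] :
    E →ₗᵢ[ℂ] FBLC E where
  toFun := delta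
  map_add' y z := by
    ext x
    obtain ⟨w, rfl⟩ := FBLC.exists_rePart x
    simp [delta_apply_rePart]
  map_smul' c z := by
    ext x
    obtain ⟨w, rfl⟩ := FBLC.exists_rePart x
    simp [delta_apply_rePart]
  norm_map' := norm_delta

/-- Evaluation at `φ ∈ (E_ℝ)^*` as a linear functional on `FBL_ℂ[E]`. -/
def FBLC.evalLinearMap (φ : E →L[ℝ] ℝ) : FBLC E →ₗ[ℂ] ℂ where
  toFun f := f φ
  map_add' f g := FBLC.add_apply f g φ
  map_smul' c f := FBLC.smul_apply c f φ

theorem FBLC.evalLinearMap_ne_zero {φ : E →L[ℝ] ℝ} (hφ : φ ≠ 0) :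
    FBLC.evalLinearMap φ ≠ 0 := by
  obtain ⟨z, hz⟩ := DFunLike.ne_iff.1 hφ
  intro h
  exact hz (congrArg Complex.re (LinearMap.congr_fun h (delta z)))

theorem extension_delta (T : E →L[ℂ] E) (z : E) : extension T (delta z) = delta (T z) :=
  (existsUnique_extension T).choose_spec.1.2 z

theorem extension_eq_compHom (T : E →L[ℂ] E) : extension T = compHom T :=
  latticeHom_ext (existsUnique_extension T).choose_spec.1.1 (isComplexLatticeHom_compHom T)
    fun z => by rw [extension_delta, compHom_delta]

theorem semiconj_delta_algebraMap_sub (T : E →L[ℂ] E) (c : ℂ) :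
    Function.Semiconj (deltaLinearIsometry E) (algebraMap ℂ (E →L[ℂ] E) c - T)
      (algebraMap ℂ (FBLC E →L[ℂ] FBLC E) c - extension T) := fun z => by
  have hT : extension T (deltaLinearIsometry E z) = deltaLinearIsometry E (T z) :=
    extension_delta T z
  simp [Algebra.algebraMap_eq_smul_one, hT]

theorem exists_antilipschitzWith_of_notMem_spectrum_extension {T : E →L[ℂ] E} {c : ℂ}
    (hc : c ∉ spectrum ℂ (extension T)) :
    ∃ K, AntilipschitzWith K (algebraMap ℂ (E →L[ℂ] E) c - T) :=
  (exists_antilipschitzWith_of_notMem_spectrum hc).imp fun _ =>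
    antilipschitzWith_of_semiconj_isometry (deltaLinearIsometry E).isometry
      (semiconj_delta_algebraMap_sub T c)

theorem mem_spectrum_extension_of_comp_eq_smul {T : E →L[ℂ] E} {r : ℝ} (hr : 0 ≤ r)
    {φ : E →L[ℝ] ℝ} (hφ : φ ≠ 0) (h : φ.comp (T.restrictScalars ℝ) = r • φ) :
    (r : ℂ) ∈ spectrum ℂ (extension T) := by
  refine mem_spectrum_of_comp_eq_smul (FBLC.evalLinearMap_ne_zero hφ) (LinearMap.ext fun f => ?_)
  calc extension T f φ = f (φ.comp (T.restrictScalars ℝ)) := by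
        rw [extension_eq_compHom, compHom_apply]
    _ = r * f φ := by rw [h, FBLC.smul_nonneg f hr]

theorem rePart_injective : Function.Injective (rePart : (E →L[ℂ] ℂ) → E →L[ℝ] ℝ) :=
  fun v w h => ContinuousLinearMap.ext fun z => by
    rw [← delta_apply_rePart, h, delta_apply_rePart]

theorem rePart_ne_zero {w : E →L[ℂ] ℂ} (hw : w ≠ 0) : rePart w ≠ 0 :=
  rePart_injective.ne hw

theorem rePart_comp_restrictScalars_of_comp_eq_smul {T : E →L[ℂ] E} {w : E →L[ℂ] ℂ} {r : ℝ}
    (h : w.comp T = (r : ℂ) • w) : (rePart w).comp (T.restrictScalars ℝ) = r • rePart w := by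
  ext z
  have hz : w (T z) = r * w z := DFunLike.congr_fun h z
  simp [rePart, hz]

end Extension

end FreeBL

theorem mainTheorem8 {E : Type*} [NormedAddCommGroup E] [NormedSpace ℂ E] [CompleteSpace E]
    (T : E →L[ℂ] E) (r : ℝ) (hr : 0 ≤ r) (hrT : (r : ℂ) ∈ spectrum ℂ T) :
    (r : ℂ) ∈ spectrum ℂ (FreeBL.extension T) := by
  by_contra hrS
  obtain ⟨K, hK⟩ := FreeBL.exists_antilipschitzWith_of_notMem_spectrum_extension hrS
  obtain ⟨w, hw, hwT⟩ :=
    FreeBL.exists_comp_eq_smul_of_mem_spectrum_of_antilipschitzWith hrT hK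
  exact hrS (FreeBL.mem_spectrum_extension_of_comp_eq_smul hr (FreeBL.rePart_ne_zero hw)
    (FreeBL.rePart_comp_restrictScalars_of_comp_eq_smul hwT))
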